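/- For $n\ge 1$ let $G_n$ be the polyomino graph with vertices $u_0,\dots,u_{2n}$, $v_0,\dots,v_{2n}$, $w_1,\dots,w_{2n}$, $z_1,\dots,z_{2n}$ and with edges $u_iu_{i+1}$ and $v_iv_{i+1}$ for $0\le i\le 2n-1$, $u_iv_i$ for $0\le i\le 2n$, $u_iw_i$ and $v_iz_i$ for $1\le i\le 2n$, and $w_{2k-1}w_{2k}$ and $z_{2k-1}z_{2k}$ for $1\le k\le n$. (Thus $G_n$ is a row of $2n$ squares in which every second square has one further square attached above it and one below it, $4n$ squares in all.) For a finite graph $G$ and a perfect matching $M$ of $G$, an anti-forcing set of $M$ is a set $S\subseteq E(G)\setminus M$ such that $M$ is the only perfect matching of the graph $G-S$ obtained from $G$ by removing the edges in $S$. The anti-forcing number $af(G,M)$ is the smallest size of an anti-forcing set of $M$, and the anti-forcing spectrum is $\mathrm{Spec}_{af}(G)=\{af(G,M): M \text{ is a perfect matching of } G\}$. The minimum and the maximum of $\mathrm{Spec}_{af}(G)$ are denoted by $af(G)$ and $Af(G)$, respectively. Then, for every integer $n\ge 1$: 1. $af(G_n)=n$ and $Af(G_n)=3n$; 2. $\mathrm{Spec}_{af}(G_n)=[n,3n]$,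 that is, the set of all integers $k$ with $n\le k\le 3n$. -/

import Mathlib

namespace AntiForcing

/-- The perfect matchings of a graph `G`, each one given as a set of edges. -/
def perfectMatchings {V : Type*} (G : SimpleGraph V) : Set (Set (Sym2 V)) :=
  {M | ∃ P : G.Subgraph, P.IsPerfectMatching ∧ P.edgeSet = M}

/-- `S` is an anti-forcing set of the perfect matching `M` of `G`: a set of edges of `G` outside
`M` such that `M` is the one and only perfect matching of the graph `G - S` (all vertices are
kept, the edges in `S` are removed). -/
def IsAntiForcingSet {V : Type*} (G : SimpleGraph V) (M S : Set (Sym2 V)) : Prop :=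
  S ⊆ G.edgeSet \ M ∧ perfectMatchings (G.deleteEdges S) = {M}

/-- The anti-forcing number of a perfect matching `M` of a finite graph `G`: the smallest size of
an anti-forcing set of `M`. (The set of sizes is non-empty, as all edges outside `M` form an
anti-forcing set.) -/
noncomputable def antiForcingNumber {V : Type*} (G : SimpleGraph V) (M : Set (Sym2 V)) : ℕ :=
  sInf {k | ∃ S : Finset (Sym2 V), IsAntiForcingSet G M (S : Set (Sym2 V)) ∧ S.card = k}

/-- The anti-forcing spectrum of a finite graph: the set of the anti-forcing numbers of all its
perfect matchings. -/
def antiForcingSpectrum {V : Type*} (G : SimpleGraph V) : Set ℕ :=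
  {k | ∃ M ∈ perfectMatchings G, antiForcingNumber G M = k}

/-- The vertices `u_0, …, u_{2n}`, `v_0, …, v_{2n}`, `w_1, …, w_{2n}`, `z_1, …, z_{2n}` of the
polyomino graph `G_n`. The indices of `w` and `z` are shifted by one: `w j` stands for `w_{j+1}`
and `z j` stands for `z_{j+1}`. -/
inductive Vertex (n : ℕ) : Type
  | u (i : Fin (2 * n + 1))
  | v (i : Fin (2 * n + 1))
  | w (j : Fin (2 * n))
  | z (j : Fin (2 * n))

/-- The edges of `G_n`, each one listed in one direction: the paths `u_0 u_1 … u_{2n}` and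
`v_0 v_1 … v_{2n}`, the edges `u_i v_i` for `0 ≤ i ≤ 2n`, the edges `u_i w_i` and `v_i z_i` for
`1 ≤ i ≤ 2n`, and the edges `w_{2k-1} w_{2k}` and `z_{2k-1} z_{2k}` for `1 ≤ k ≤ n`. -/
def edgeRel {n : ℕ} : Vertex n → Vertex n → Prop
  | .u i, .u j => (j : ℕ) = (i : ℕ) + 1
  | .v i, .v j => (j : ℕ) = (i : ℕ) + 1
  | .u i, .v j => i = j
  | .u i, .w j => (i : ℕ) = (j : ℕ) + 1
  | .v i, .z j => (i : ℕ) = (j : ℕ) + 1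
  | .w i, .w j => Even (i : ℕ) ∧ (j : ℕ) = (i : ℕ) + 1
  | .z i, .z j => Even (i : ℕ) ∧ (j : ℕ) = (i : ℕ) + 1
  | _, _ => False

/-- The polyomino graph `G_n` with `4n` squares: a horizontal row of `2n` squares
`u_{i-1} u_i v_i v_{i-1}`, where the 2nd, 4th, …, `2n`-th of them has one further square attached
above it and one below it. -/
def polyominoGraph (n : ℕ) : SimpleGraph (Vertex n) :=
  SimpleGraph.fromRel edgeRel

end AntiForcing

/-! The graph splits into `n` blocks of four squares. In a perfect matching the two connecting edges
to the left of a block are both present or both absent (`vl_eq_ul`). With `p` and `q` the indicators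
of the connecting pairs on its left and right, a block has one state for each of `(1,1)`, `(1,0)`,
`(0,1)`, and five states for `(0,0)`.

Upper bounds come from an explicit anti-forcing set, chosen block by block by `IsForcingLabel`. A
matching avoiding it has no connecting pair where `M` has none, by induction from the right end. It
has every pair of `M`, by induction from the left end, and then the blocks agree (`eq_of_forcing`).
Up to a telescoping term `q - p`, a block costs at most 1 if `p = 1`, 2 if it uses all four pendant
edges `u_i w_i`, `v_i z_i`, and 3 otherwise, so at most `3n` in total.

Lower bounds use only alternating squares. Switching one yields another perfect matching, so an
anti-forcing set contains one of its two non-matching edges. Choosing squares whose non-matching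
edges are disjoint gives at least `n` for every matching (`MeetsSquares.le_total`).

For the matchings with `a` blocks of cost 1, then `b` of cost 2, then the rest of cost 3, both
bounds equal `n + (n-a) + (n-a-b)`. These values fill `[n, 3n]`. -/

namespace AntiForcing

/-! ### Perfect matchings as edge sets; alternating squares -/

section General

variable {V : Type*} {G : SimpleGraph V} {M S : Set (Sym2 V)}

theorem mem_perfectMatchings_iff :
    M ∈ perfectMatchings G ↔ M ⊆ G.edgeSet ∧ ∀ x, ∃! e, e ∈ M ∧ x ∈ e := by
  constructor
  · rintro ⟨P, ⟨hm, hs⟩, rfl⟩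
    refine ⟨P.edgeSet_subset, fun x => ?_⟩
    obtain ⟨y, hy, hu⟩ := hm (hs x)
    refine ⟨s(x, y), ⟨hy, Sym2.mem_mk_left x y⟩, ?_⟩
    rintro e ⟨he, hx⟩
    obtain ⟨z, rfl⟩ := Sym2.mem_iff_exists.1 hx
    rw [hu z he]
  · rintro ⟨hM, h⟩
    refine ⟨⟨Set.univ, fun a b => s(a, b) ∈ M, fun hab => hM hab, fun _ => Set.mem_univ _,
      ⟨fun a b hab => by rwa [Sym2.eq_swap]⟩⟩, ⟨fun x _ => ?_, fun x => Set.mem_univ x⟩, ?_⟩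
    · obtain ⟨e, ⟨he, hx⟩, hu⟩ := h x
      obtain ⟨z, rfl⟩ := Sym2.mem_iff_exists.1 hx
      refine ⟨z, he, fun y hy => ?_⟩
      exact Sym2.congr_right.1 (hu s(x, y) ⟨hy, Sym2.mem_mk_left x y⟩)
    · ext e
      induction e using Sym2.ind with
      | _ a b => exact Iff.rfl

theorem mem_perfectMatchings_deleteEdges_iff :
    M ∈ perfectMatchings (G.deleteEdges S) ↔ M ∈ perfectMatchings G ∧ Disjoint M S := by
  rw [mem_perfectMatchings_iff, mem_perfectMatchings_iff, SimpleGraph.edgeSet_deleteEdges,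
    Set.subset_sdiff]
  tauto

/-- An anti-forcing set meets every alternating 4-cycle. -/
theorem IsAntiForcingSet.mem_or_mem (h : IsAntiForcingSet G M S) {a b c d : V}
    (hab : s(a, b) ∈ M) (hcd : s(c, d) ∈ M) (hbc : G.Adj b c) (hda : G.Adj d a)
    (hac : a ≠ c) (hbd : b ≠ d) : s(b, c) ∈ S ∨ s(d, a) ∈ S := by
  by_contra! hS
  have hM : M ∈ perfectMatchings (G.deleteEdges S) := by rw [h.2]; rfl
  rw [mem_perfectMatchings_deleteEdges_iff, mem_perfectMatchings_iff] at hM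
  obtain ⟨⟨hMG, hMu⟩, hMS⟩ := hM
  have hab' : a ≠ b := (hMG hab : G.Adj a b).ne
  have hcd' : c ≠ d := (hMG hcd : G.Adj c d).ne
  have hbc' := hbc.ne
  have hda' := hda.ne
  have huniq : ∀ {x e e'}, e ∈ M → x ∈ e → e' ∈ M → x ∈ e' → e = e' :=
    fun he hx he' hx' => (hMu _).unique ⟨he, hx⟩ ⟨he', hx'⟩
  -- If neither edge is removed, the matching switched along the 4-cycle survives the deletion,
  -- against uniqueness.
  have hM' : (M \ {s(a, b), s(c, d)}) ∪ {s(b, c), s(d, a)} ∈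
      perfectMatchings (G.deleteEdges S) := by
    rw [mem_perfectMatchings_deleteEdges_iff, mem_perfectMatchings_iff]
    refine ⟨⟨?_, fun x => ?_⟩, ?_⟩
    · rintro e (he | rfl | rfl)
      · exact hMG he.1
      · exact hbc
      · exact hda
    · have key : ∀ e ∈ M \ {s(a, b), s(c, d)}, a ∉ e ∧ b ∉ e ∧ c ∉ e ∧ d ∉ e := by
        rintro e ⟨he, hne⟩
        simp only [Set.mem_insert_iff, Set.mem_singleton_iff, not_or] at hne
        exact ⟨fun hx => hne.1 (huniq he hx hab (by simp)),
          fun hx => hne.1 (huniq he hx hab (by simp)),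
          fun hx => hne.2 (huniq he hx hcd (by simp)),
          fun hx => hne.2 (huniq he hx hcd (by simp))⟩
      by_cases hxb : x = b ∨ x = c
      · refine ⟨s(b, c), ⟨by simp, by simpa using hxb⟩, ?_⟩
        rintro e ⟨he | rfl | rfl, hx⟩
        · have := key e he
          rcases hxb with rfl | rfl <;> tauto
        · rfl
        · rcases hxb with rfl | rfl <;> simp_all
      by_cases hxd : x = d ∨ x = a
      · refine ⟨s(d, a), ⟨by simp, by simpa using hxd⟩, ?_⟩
        rintro e ⟨he | rfl | rfl, hx⟩
        · have := key e he
          rcases hxd with rfl | rfl <;> tauto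
        · rcases hxd with rfl | rfl <;> simp_all
        · rfl
      obtain ⟨e, ⟨he, hx⟩, hu⟩ := hMu x
      refine ⟨e, ⟨Or.inl ⟨he, ?_⟩, hx⟩, ?_⟩
      · rintro (rfl | rfl) <;> simp at hx <;> tauto
      · rintro e' ⟨he' | rfl | rfl, hx'⟩
        · exact hu e' ⟨he'.1, hx'⟩
        · simp at hx'; tauto
        · simp at hx'; tauto
    · rw [Set.disjoint_left] at hMS ⊢
      rintro e (he | rfl | rfl)
      · exact hMS he.1
      · exact hS.1
      · exact hS.2
  rw [h.2, Set.mem_singleton_iff] at hM'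
  have hmem : s(b, c) ∈ M := by rw [← hM']; simp
  have := huniq hab (Sym2.mem_mk_right a b) hmem (Sym2.mem_mk_left b c)
  rw [Sym2.eq_iff] at this
  tauto

theorem antiForcingNumber_le {T : Finset (Sym2 V)} (h : IsAntiForcingSet G M T) {k : ℕ}
    (hk : T.card ≤ k) : antiForcingNumber G M ≤ k := by
  refine le_trans (Nat.sInf_le ?_) hk
  exact ⟨T, h, rfl⟩

/-- A witness `T` is needed because `sInf ∅ = 0` on `ℕ`. -/
theorem le_antiForcingNumber {T : Finset (Sym2 V)} (hT : IsAntiForcingSet G M T) {k : ℕ}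
    (h : ∀ T : Finset (Sym2 V), IsAntiForcingSet G M T → k ≤ T.card) :
    k ≤ antiForcingNumber G M := by
  have hne : {k | ∃ T : Finset (Sym2 V), IsAntiForcingSet G M (T : Set (Sym2 V)) ∧
    T.card = k}.Nonempty := ⟨_, T, hT, rfl⟩
  obtain ⟨T', hT', hc⟩ := Nat.sInf_mem hne
  exact (h T' hT').trans hc.le

end General

/-! ### Blocks and names for the edges -/

/-- The edges of a block of `G_n`. The `k`-th block consists of the columns `2k+1` and `2k+2`
(odd and even column), together with the two edges that lead to the column `2k`. -/
inductive Label
  | ul | vl | u | v | xo | xe | ao | ae | bo | be | c | d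
  deriving DecidableEq

instance : Fintype Label where
  elems := {.ul, .vl, .u, .v, .xo, .xe, .ao, .ae, .bo, .be, .c, .d}
  complete l := by cases l <;> decide

theorem sum_label {α : Type*} [AddCommMonoid α] (g : Label → α) :
    ∑ l, g l = g .ul + g .vl + g .u + g .v + g .xo + g .xe + g .ao + g .ae + g .bo + g .be +
      g .c + g .d := by
  change ∑ l ∈ ({.ul, .vl, .u, .v, .xo, .xe, .ao, .ae, .bo, .be, .c, .d} : Finset Label), g l = _
  simp [add_assoc]

/-- The edge of `G_n` with a given name; `none` stands for `u_0 v_0`. -/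
def edge {n : ℕ} : Option (Fin n × Label) → Sym2 (Vertex n)
  | none => s(.u ⟨0, by omega⟩, .v ⟨0, by omega⟩)
  | some (k, .ul) => s(.u ⟨2 * k, by omega⟩, .u ⟨2 * k + 1, by omega⟩)
  | some (k, .vl) => s(.v ⟨2 * k, by omega⟩, .v ⟨2 * k + 1, by omega⟩)
  | some (k, .u) => s(.u ⟨2 * k + 1, by omega⟩, .u ⟨2 * k + 2, by omega⟩)
  | some (k, .v) => s(.v ⟨2 * k + 1, by omega⟩, .v ⟨2 * k + 2, by omega⟩)
  | some (k, .xo) => s(.u ⟨2 * k + 1, by omega⟩, .v ⟨2 * k + 1, by omega⟩)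
  | some (k, .xe) => s(.u ⟨2 * k + 2, by omega⟩, .v ⟨2 * k + 2, by omega⟩)
  | some (k, .ao) => s(.u ⟨2 * k + 1, by omega⟩, .w ⟨2 * k, by omega⟩)
  | some (k, .ae) => s(.u ⟨2 * k + 2, by omega⟩, .w ⟨2 * k + 1, by omega⟩)
  | some (k, .bo) => s(.v ⟨2 * k + 1, by omega⟩, .z ⟨2 * k, by omega⟩)
  | some (k, .be) => s(.v ⟨2 * k + 2, by omega⟩, .z ⟨2 * k + 1, by omega⟩)
  | some (k, .c) => s(.w ⟨2 * k, by omega⟩, .w ⟨2 * k + 1, by omega⟩)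
  | some (k, .d) => s(.z ⟨2 * k, by omega⟩, .z ⟨2 * k + 1, by omega⟩)

variable {n : ℕ}

theorem edge_injective : Function.Injective (edge (n := n)) := by
  rintro (_ | ⟨i, _ | _⟩) (_ | ⟨j, _ | _⟩) h <;>
    simp [edge, Fin.ext_iff] at h ⊢ <;> omega

theorem edge_mem_edgeSet (e : Option (Fin n × Label)) : edge e ∈ (polyominoGraph n).edgeSet := by
  rcases e with _ | ⟨i, _ | _⟩ <;>
    simp [edge, polyominoGraph, edgeRel, Fin.ext_iff]

theorem exists_block_of_odd_or_even (i : ℕ) : i = 0 ∨ ∃ k, i = 2 * k + 1 ∨ i = 2 * k + 2 := by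
  rcases i with _ | i
  · exact Or.inl rfl
  · exact Or.inr ⟨i / 2, by omega⟩

theorem exists_edge_of_edgeRel {a b : Vertex n} (h : edgeRel a b) : ∃ e, edge e = s(a, b) := by
  rcases a with ⟨i, hi⟩ | ⟨i, hi⟩ | ⟨i, hi⟩ | ⟨i, hi⟩ <;>
    rcases b with ⟨j, hj⟩ | ⟨j, hj⟩ | ⟨j, hj⟩ | ⟨j, hj⟩ <;>
    simp only [edgeRel, Fin.mk.injEq] at h
  · subst h
    rcases Nat.even_or_odd' i with ⟨k, rfl | rfl⟩
    · exact ⟨some (⟨k, by omega⟩, .ul), rfl⟩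
    · exact ⟨some (⟨k, by omega⟩, .u), rfl⟩
  · subst h
    obtain rfl | ⟨k, rfl | rfl⟩ := exists_block_of_odd_or_even i
    · exact ⟨none, rfl⟩
    · exact ⟨some (⟨k, by omega⟩, .xo), rfl⟩
    · exact ⟨some (⟨k, by omega⟩, .xe), rfl⟩
  · subst h
    rcases Nat.even_or_odd' j with ⟨k, rfl | rfl⟩
    · exact ⟨some (⟨k, by omega⟩, .ao), rfl⟩
    · exact ⟨some (⟨k, by omega⟩, .ae), rfl⟩
  · subst h
    rcases Nat.even_or_odd' i with ⟨k, rfl | rfl⟩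
    · exact ⟨some (⟨k, by omega⟩, .vl), rfl⟩
    · exact ⟨some (⟨k, by omega⟩, .v), rfl⟩
  · subst h
    rcases Nat.even_or_odd' j with ⟨k, rfl | rfl⟩
    · exact ⟨some (⟨k, by omega⟩, .bo), rfl⟩
    · exact ⟨some (⟨k, by omega⟩, .be), rfl⟩
  · obtain ⟨⟨k, hk⟩, rfl⟩ := h
    obtain rfl : i = 2 * k := by omega
    exact ⟨some (⟨k, by omega⟩, .c), rfl⟩
  · obtain ⟨⟨k, hk⟩, rfl⟩ := h
    obtain rfl : i = 2 * k := by omega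
    exact ⟨some (⟨k, by omega⟩, .d), rfl⟩

theorem range_edge : Set.range (edge (n := n)) = (polyominoGraph n).edgeSet := by
  apply Set.Subset.antisymm
  · rintro _ ⟨e, rfl⟩
    exact edge_mem_edgeSet e
  · intro e
    induction e using Sym2.ind with
    | _ a b =>
      rintro ⟨-, h | h⟩
      · exact exists_edge_of_edgeRel h
      · rw [Sym2.eq_swap]
        exact exists_edge_of_edgeRel h

/-! ### Perfect matchings as 0/1 solutions of the degree equations -/

open Classical in
/-- The indicator function of a set of edges of `G_n` on the edges of the `k`-th block. -/
noncomputable def blockInd (M : Set (Sym2 (Vertex n))) (k : ℕ) (l : Label) : ℕ :=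
  if h : k < n then (if edge (some (⟨k, h⟩, l)) ∈ M then 1 else 0) else 0

open Classical in
/-- The indicator function of a set of edges of `G_n` at the edge `u_0 v_0`. -/
noncomputable def baseInd (M : Set (Sym2 (Vertex n))) : ℕ :=
  if edge none ∈ M then 1 else 0

/-- The numbers `x` and `f k l` solve the system of equations which says that every vertex of
`G_n` is covered once. -/
structure IsMatchingVector (n : ℕ) (x : ℕ) (f : ℕ → Label → ℕ) : Prop where
  u_zero : x + f 0 .ul = 1
  v_zero : x + f 0 .vl = 1
  u_odd : ∀ k < n, f k .ul + f k .u + f k .xo + f k .ao = 1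
  v_odd : ∀ k < n, f k .vl + f k .v + f k .xo + f k .bo = 1
  u_even : ∀ k < n, f k .u + f k .xe + f k .ae + f (k + 1) .ul = 1
  v_even : ∀ k < n, f k .v + f k .xe + f k .be + f (k + 1) .vl = 1
  w_odd : ∀ k < n, f k .ao + f k .c = 1
  w_even : ∀ k < n, f k .ae + f k .c = 1
  z_odd : ∀ k < n, f k .bo + f k .d = 1
  z_even : ∀ k < n, f k .be + f k .d = 1
  ul_last : f n .ul = 0
  vl_last : f n .vl = 0

theorem existsUnique_mem_iff_sum_eq_one {M : Set (Sym2 (Vertex n))}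
    (hM : M ⊆ (polyominoGraph n).edgeSet) {x : Vertex n} (L : Finset (Option (Fin n × Label)))
    (hL : ∀ e, x ∈ edge e ↔ e ∈ L) [DecidablePred (· ∈ M)] :
    (∃! e, e ∈ M ∧ x ∈ e) ↔ ∑ e ∈ L, (if edge e ∈ M then 1 else 0) = 1 := by
  rw [← Finset.card_filter, Finset.card_eq_one]
  constructor
  · rintro ⟨e, ⟨he, hx⟩, hu⟩
    obtain ⟨e, rfl⟩ := range_edge.ge (hM he)
    refine ⟨e, ?_⟩
    ext e'
    rw [Finset.mem_filter, Finset.mem_singleton, ← hL]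
    constructor
    · rintro ⟨hx', he'⟩
      exact edge_injective (hu _ ⟨he', hx'⟩)
    · rintro rfl
      exact ⟨hx, he⟩
  · rintro ⟨e, he⟩
    have key : ∀ e', (x ∈ edge e' ∧ edge e' ∈ M) ↔ e' = e := fun e' => by
      rw [hL, ← Finset.mem_singleton, ← he, Finset.mem_filter]
    refine ⟨edge e, ((key e).2 rfl).symm, ?_⟩
    rintro e' ⟨he', hx'⟩
    obtain ⟨e', rfl⟩ := range_edge.ge (hM he')
    rw [(key e').1 ⟨hx', he'⟩]

theorem forall_vertex_iff {p : Vertex n → Prop} :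
    (∀ x, p x) ↔ p (.u ⟨0, by omega⟩) ∧ p (.v ⟨0, by omega⟩) ∧ ∀ (k : ℕ) (h : k < n),
      p (.u ⟨2 * k + 1, by omega⟩) ∧ p (.u ⟨2 * k + 2, by omega⟩) ∧
      p (.v ⟨2 * k + 1, by omega⟩) ∧ p (.v ⟨2 * k + 2, by omega⟩) ∧
      p (.w ⟨2 * k, by omega⟩) ∧ p (.w ⟨2 * k + 1, by omega⟩) ∧
      p (.z ⟨2 * k, by omega⟩) ∧ p (.z ⟨2 * k + 1, by omega⟩) := by
  constructor
  · intro h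
    exact ⟨h _, h _, fun k hk => ⟨h _, h _, h _, h _, h _, h _, h _, h _⟩⟩
  · rintro ⟨hu, hv, h⟩ (⟨i, hi⟩ | ⟨i, hi⟩ | ⟨i, hi⟩ | ⟨i, hi⟩)
    · obtain rfl | ⟨k, rfl | rfl⟩ := exists_block_of_odd_or_even i
      · exact hu
      · exact (h k (by omega)).1
      · exact (h k (by omega)).2.1
    · obtain rfl | ⟨k, rfl | rfl⟩ := exists_block_of_odd_or_even i
      · exact hv
      · exact (h k (by omega)).2.2.1
      · exact (h k (by omega)).2.2.2.1
    · obtain ⟨k, rfl | rfl⟩ := Nat.even_or_odd' i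
      · exact (h k (by omega)).2.2.2.2.1
      · exact (h k (by omega)).2.2.2.2.2.1
    · obtain ⟨k, rfl | rfl⟩ := Nat.even_or_odd' i
      · exact (h k (by omega)).2.2.2.2.2.2.1
      · exact (h k (by omega)).2.2.2.2.2.2.2

section Degree

variable {M : Set (Sym2 (Vertex n))} {k : ℕ}

theorem existsUnique_u_zero (hM : M ⊆ (polyominoGraph n).edgeSet) (hn : 0 < n) :
    (∃! e, e ∈ M ∧ Vertex.u ⟨0, by omega⟩ ∈ e) ↔ baseInd M + blockInd M 0 .ul = 1 := by
  classical
  rw [existsUnique_mem_iff_sum_eq_one hM {none, some (⟨0, hn⟩, .ul)}]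
  · simp [-Finset.sum_boole, baseInd, blockInd, hn]
  · rintro (_ | ⟨i, _ | _⟩) <;> simp [edge, Fin.ext_iff]

theorem existsUnique_v_zero (hM : M ⊆ (polyominoGraph n).edgeSet) (hn : 0 < n) :
    (∃! e, e ∈ M ∧ Vertex.v ⟨0, by omega⟩ ∈ e) ↔ baseInd M + blockInd M 0 .vl = 1 := by
  classical
  rw [existsUnique_mem_iff_sum_eq_one hM {none, some (⟨0, hn⟩, .vl)}]
  · simp [-Finset.sum_boole, baseInd, blockInd, hn]
  · rintro (_ | ⟨i, _ | _⟩) <;> simp [edge, Fin.ext_iff]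

theorem existsUnique_u_odd (hM : M ⊆ (polyominoGraph n).edgeSet) (hk : k < n) :
    (∃! e, e ∈ M ∧ Vertex.u ⟨2 * k + 1, by omega⟩ ∈ e) ↔
    blockInd M k .ul + blockInd M k .u + blockInd M k .xo + blockInd M k .ao = 1 := by
  classical
  rw [existsUnique_mem_iff_sum_eq_one hM {some (⟨k, hk⟩, .ul), some (⟨k, hk⟩, .u),
    some (⟨k, hk⟩, .xo), some (⟨k, hk⟩, .ao)}]
  · simp [-Finset.sum_boole, blockInd, hk, add_assoc]
  · rintro (_ | ⟨i, _ | _⟩) <;> simp [edge, Fin.ext_iff] <;> omega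

theorem existsUnique_v_odd (hM : M ⊆ (polyominoGraph n).edgeSet) (hk : k < n) :
    (∃! e, e ∈ M ∧ Vertex.v ⟨2 * k + 1, by omega⟩ ∈ e) ↔
    blockInd M k .vl + blockInd M k .v + blockInd M k .xo + blockInd M k .bo = 1 := by
  classical
  rw [existsUnique_mem_iff_sum_eq_one hM {some (⟨k, hk⟩, .vl), some (⟨k, hk⟩, .v),
    some (⟨k, hk⟩, .xo), some (⟨k, hk⟩, .bo)}]
  · simp [-Finset.sum_boole, blockInd, hk, add_assoc]
  · rintro (_ | ⟨i, _ | _⟩) <;> simp [edge, Fin.ext_iff] <;> omega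

theorem existsUnique_u_even (hM : M ⊆ (polyominoGraph n).edgeSet) (hk : k < n) :
    (∃! e, e ∈ M ∧ Vertex.u ⟨2 * k + 2, by omega⟩ ∈ e) ↔
    blockInd M k .u + blockInd M k .xe + blockInd M k .ae + blockInd M (k + 1) .ul = 1 := by
  classical
  by_cases hk' : k + 1 < n
  · rw [existsUnique_mem_iff_sum_eq_one hM {some (⟨k, hk⟩, .u), some (⟨k, hk⟩, .xe),
      some (⟨k, hk⟩, .ae), some (⟨k + 1, hk'⟩, .ul)}]
    · simp [-Finset.sum_boole, blockInd, hk, hk', add_assoc]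
    · rintro (_ | ⟨i, _ | _⟩) <;> simp [edge, Fin.ext_iff] <;> omega
  -- The last block has no successor; the default value 0 of `blockInd` at `k + 1 = n` keeps the
  -- equation uniform.
  · rw [existsUnique_mem_iff_sum_eq_one hM {some (⟨k, hk⟩, .u), some (⟨k, hk⟩, .xe),
      some (⟨k, hk⟩, .ae)}]
    · simp [-Finset.sum_boole, blockInd, hk, hk', add_assoc]
    · rintro (_ | ⟨i, _ | _⟩) <;> simp [edge, Fin.ext_iff] <;> omega

theorem existsUnique_v_even (hM : M ⊆ (polyominoGraph n).edgeSet) (hk : k < n) :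
    (∃! e, e ∈ M ∧ Vertex.v ⟨2 * k + 2, by omega⟩ ∈ e) ↔
    blockInd M k .v + blockInd M k .xe + blockInd M k .be + blockInd M (k + 1) .vl = 1 := by
  classical
  by_cases hk' : k + 1 < n
  · rw [existsUnique_mem_iff_sum_eq_one hM {some (⟨k, hk⟩, .v), some (⟨k, hk⟩, .xe),
      some (⟨k, hk⟩, .be), some (⟨k + 1, hk'⟩, .vl)}]
    · simp [-Finset.sum_boole, blockInd, hk, hk', add_assoc]
    · rintro (_ | ⟨i, _ | _⟩) <;> simp [edge, Fin.ext_iff] <;> omega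
  · rw [existsUnique_mem_iff_sum_eq_one hM {some (⟨k, hk⟩, .v), some (⟨k, hk⟩, .xe),
      some (⟨k, hk⟩, .be)}]
    · simp [-Finset.sum_boole, blockInd, hk, hk', add_assoc]
    · rintro (_ | ⟨i, _ | _⟩) <;> simp [edge, Fin.ext_iff] <;> omega

theorem existsUnique_w_odd (hM : M ⊆ (polyominoGraph n).edgeSet) (hk : k < n) :
    (∃! e, e ∈ M ∧ Vertex.w ⟨2 * k, by omega⟩ ∈ e) ↔
    blockInd M k .ao + blockInd M k .c = 1 := by
  classical
  rw [existsUnique_mem_iff_sum_eq_one hM {some (⟨k, hk⟩, .ao), some (⟨k, hk⟩, .c)}]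
  · simp [-Finset.sum_boole, blockInd, hk]
  · rintro (_ | ⟨i, _ | _⟩) <;> simp [edge, Fin.ext_iff] <;> omega

theorem existsUnique_w_even (hM : M ⊆ (polyominoGraph n).edgeSet) (hk : k < n) :
    (∃! e, e ∈ M ∧ Vertex.w ⟨2 * k + 1, by omega⟩ ∈ e) ↔
    blockInd M k .ae + blockInd M k .c = 1 := by
  classical
  rw [existsUnique_mem_iff_sum_eq_one hM {some (⟨k, hk⟩, .ae), some (⟨k, hk⟩, .c)}]
  · simp [-Finset.sum_boole, blockInd, hk]
  · rintro (_ | ⟨i, _ | _⟩) <;> simp [edge, Fin.ext_iff] <;> omega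

theorem existsUnique_z_odd (hM : M ⊆ (polyominoGraph n).edgeSet) (hk : k < n) :
    (∃! e, e ∈ M ∧ Vertex.z ⟨2 * k, by omega⟩ ∈ e) ↔
    blockInd M k .bo + blockInd M k .d = 1 := by
  classical
  rw [existsUnique_mem_iff_sum_eq_one hM {some (⟨k, hk⟩, .bo), some (⟨k, hk⟩, .d)}]
  · simp [-Finset.sum_boole, blockInd, hk]
  · rintro (_ | ⟨i, _ | _⟩) <;> simp [edge, Fin.ext_iff] <;> omega

theorem existsUnique_z_even (hM : M ⊆ (polyominoGraph n).edgeSet) (hk : k < n) :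
    (∃! e, e ∈ M ∧ Vertex.z ⟨2 * k + 1, by omega⟩ ∈ e) ↔
    blockInd M k .be + blockInd M k .d = 1 := by
  classical
  rw [existsUnique_mem_iff_sum_eq_one hM {some (⟨k, hk⟩, .be), some (⟨k, hk⟩, .d)}]
  · simp [-Finset.sum_boole, blockInd, hk]
  · rintro (_ | ⟨i, _ | _⟩) <;> simp [edge, Fin.ext_iff] <;> omega

theorem mem_perfectMatchings_iff_isMatchingVector (hM : M ⊆ (polyominoGraph n).edgeSet)
    (hn : 0 < n) :
    M ∈ perfectMatchings (polyominoGraph n) ↔ IsMatchingVector n (baseInd M) (blockInd M) := by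
  have hlast : ∀ l, blockInd M n l = 0 := fun l => by simp [blockInd]
  rw [mem_perfectMatchings_iff, and_iff_right hM, forall_vertex_iff, existsUnique_u_zero hM hn,
    existsUnique_v_zero hM hn]
  constructor
  · rintro ⟨hu, hv, h⟩
    exact ⟨hu, hv, fun k hk => (existsUnique_u_odd hM hk).1 (h k hk).1,
      fun k hk => (existsUnique_v_odd hM hk).1 (h k hk).2.2.1,
      fun k hk => (existsUnique_u_even hM hk).1 (h k hk).2.1,
      fun k hk => (existsUnique_v_even hM hk).1 (h k hk).2.2.2.1,
      fun k hk => (existsUnique_w_odd hM hk).1 (h k hk).2.2.2.2.1,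
      fun k hk => (existsUnique_w_even hM hk).1 (h k hk).2.2.2.2.2.1,
      fun k hk => (existsUnique_z_odd hM hk).1 (h k hk).2.2.2.2.2.2.1,
      fun k hk => (existsUnique_z_even hM hk).1 (h k hk).2.2.2.2.2.2.2, hlast _, hlast _⟩
  · intro h
    exact ⟨h.u_zero, h.v_zero, fun k hk => ⟨(existsUnique_u_odd hM hk).2 (h.u_odd k hk),
      (existsUnique_u_even hM hk).2 (h.u_even k hk), (existsUnique_v_odd hM hk).2 (h.v_odd k hk),
      (existsUnique_v_even hM hk).2 (h.v_even k hk), (existsUnique_w_odd hM hk).2 (h.w_odd k hk),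
      (existsUnique_w_even hM hk).2 (h.w_even k hk), (existsUnique_z_odd hM hk).2 (h.z_odd k hk),
      (existsUnique_z_even hM hk).2 (h.z_even k hk)⟩⟩

end Degree

/-! ### Local states of a block -/

namespace IsMatchingVector

variable {n x x' : ℕ} {f f' : ℕ → Label → ℕ}

/-- The `w` and `z` equations give `ao = ae` and `bo = be`. Comparing the equations at the odd and
even columns then shows that `ul - vl` does not change from one block to the next. It is 0 at the
start, where both equal `1 - x`. -/
theorem vl_eq_ul (h : IsMatchingVector n x f) {k : ℕ} (hk : k ≤ n) : f k .vl = f k .ul := by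
  induction k with
  | zero => have := h.u_zero; have := h.v_zero; omega
  | succ k ih =>
    have := ih (by omega)
    have := h.u_odd k hk; have := h.v_odd k hk; have := h.u_even k hk; have := h.v_even k hk
    have := h.w_odd k hk; have := h.w_even k hk; have := h.z_odd k hk; have := h.z_even k hk
    omega

/-- The equations of a block with the unknowns reduced to one for each pair of equal ones. -/
theorem block (h : IsMatchingVector n x f) {k : ℕ} (hk : k < n) :
    f k .vl = f k .ul ∧ f (k + 1) .vl = f (k + 1) .ul ∧ f k .ae = f k .ao ∧ f k .be = f k .bo ∧
    f k .c + f k .ao = 1 ∧ f k .d + f k .bo = 1 ∧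
    f k .ul + f k .u + f k .xo + f k .ao = 1 ∧ f k .ul + f k .v + f k .xo + f k .bo = 1 ∧
    f k .u + f k .xe + f k .ao + f (k + 1) .ul = 1 ∧
    f k .v + f k .xe + f k .bo + f (k + 1) .ul = 1 := by
  have := h.vl_eq_ul hk.le; have := h.vl_eq_ul hk
  have := h.u_odd k hk; have := h.v_odd k hk; have := h.u_even k hk; have := h.v_even k hk
  have := h.w_odd k hk; have := h.w_even k hk; have := h.z_odd k hk; have := h.z_even k hk
  omega

/-- The eight perfect matchings of a block. -/
theorem block_cases (h : IsMatchingVector n x f) {k : ℕ} (hk : k < n) :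
    (f k .ul = 1 ∧ f (k + 1) .ul = 1) ∨ (f k .ul = 1 ∧ f (k + 1) .ul = 0) ∨
    (f k .ul = 0 ∧ f (k + 1) .ul = 1) ∨ (f k .ao = 1 ∧ f k .bo = 1) ∨
    (f k .ao = 1 ∧ f k .bo = 0) ∨ (f k .ao = 0 ∧ f k .bo = 1) ∨
    (f k .u = 1 ∧ f k .v = 1) ∨ (f k .xo = 1 ∧ f k .xe = 1) := by
  have := h.block hk
  omega

end IsMatchingVector

/-! ### The forcing labels and uniqueness of the matching avoiding them -/

/-- The edges of a block that are put into an anti-forcing set of a perfect matching: `g` is the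
indicator function of the matching on the block, and `q` its value on the edges that lead to the
next block. -/
def IsForcingLabel (q : ℕ) (g : Label → ℕ) : Label → Prop
  | .ul => g .ul = 0 ∧ ¬ (g .ao = 1 ∧ g .bo = 1) ∧ ¬ (g .u = 1 ∧ g .v = 1)
  | .u => g .xo = 1 ∧ g .xe = 1
  | .v => g .ul = 0 ∧ q = 1
  | .xe => q = 1 ∨ (g .u = 1 ∧ g .v = 1)
  | .ao => (g .ao = 0 ∧ g .bo = 1) ∨ (g .u = 1 ∧ g .v = 1) ∨ (g .xo = 1 ∧ g .xe = 1)
  | .bo => (g .ul = 0 ∧ q = 1) ∨ (g .ao = 1 ∧ g .bo = 0) ∨ (g .u = 1 ∧ g .v = 1)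
  | .c => g .ao = 1
  | .d => g .bo = 1
  | _ => False

namespace IsMatchingVector

variable {n x x' : ℕ} {f f' : ℕ → Label → ℕ}

theorem eq_zero_of_isForcingLabel (h : IsMatchingVector n x f) {k : ℕ} (hk : k < n) {l : Label}
    (hl : IsForcingLabel (f (k + 1) .ul) (f k) l) : f k l = 0 := by
  have hb := h.block hk
  cases l <;> simp only [IsForcingLabel] at hl <;> omega

/-- If the connecting edges to the left of a block do not belong to the matching `f`, then they
do not belong to a matching `f'` avoiding the forcing labels of the block. -/
theorem ul_eq_zero_of_forcing (h : IsMatchingVector n x f) (h' : IsMatchingVector n x' f')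
    {k : ℕ} (hk : k < n) (hf : ∀ l, IsForcingLabel (f (k + 1) .ul) (f k) l → f' k l = 0)
    (hq : f (k + 1) .ul = 0 → f' (k + 1) .ul = 0) (hp : f k .ul = 0) : f' k .ul = 0 := by
  have hb := h.block hk
  have hb' := h'.block hk
  have hul := hf .ul
  have hc := hf .c
  have hxe := hf .xe
  simp only [IsForcingLabel] at hul hc hxe
  clear hf h h'
  -- Either `ul` itself is a forcing label, or `ao = bo = 1` and the label `c` makes `f' k .ao = 1`,
  -- or `u = v = 1` and `q = 0`. In the last case `xe` and the right pair vanish in `f'`, so `u` or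
  -- `ao` covers `u_{2k+2}`, hence also accounts for `u_{2k+1}` or its pendant edge, excluding `ul`.
  omega

/-- The edges `v`, `bo`, `xe` all vanish in `f'`: `xe` is a forcing label, and the other two are
forcing labels if `ul = 0` and are excluded by `ul = 1` otherwise. Only the connecting edge is left
to cover `v_{2k+2}`. -/
theorem ul_eq_one_of_forcing (h : IsMatchingVector n x f) (h' : IsMatchingVector n x' f')
    {k : ℕ} (hk : k < n) (hf : ∀ l, IsForcingLabel (f (k + 1) .ul) (f k) l → f' k l = 0)
    (hp : f' k .ul = f k .ul) (hq : f (k + 1) .ul = 1) : f' (k + 1) .ul = 1 := by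
  have hb := h.block hk
  have hb' := h'.block hk
  have hv := hf .v
  have hbo := hf .bo
  have hxe := hf .xe
  simp only [IsForcingLabel] at hv hbo hxe
  clear hf h h'
  omega

theorem block_eq_of_forcing (h : IsMatchingVector n x f) (h' : IsMatchingVector n x' f')
    {k : ℕ} (hk : k < n) (hf : ∀ l, IsForcingLabel (f (k + 1) .ul) (f k) l → f' k l = 0)
    (hp : f' k .ul = f k .ul) (hq : f' (k + 1) .ul = f (k + 1) .ul) (l : Label) :
    f' k l = f k l := by
  have hcases := h.block_cases hk
  have hb := h.block hk
  have hb' := h'.block hk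
  clear h h'
  generalize f k = g at *
  generalize f' k = g' at *
  generalize f (k + 1) .ul = q at *
  generalize f' (k + 1) .ul = q' at *
  obtain ⟨h1, -, h2, h3, hb⟩ := hb
  obtain ⟨h1', -, h2', h3', hb'⟩ := hb'
  -- Given both connecting pairs, these three values determine the block through the degree
  -- equations.
  have heq : g' .ao = g .ao ∧ g' .bo = g .bo ∧ g' .xo = g .xo := by
    rcases hcases with hc | hc | hc | hc | hc | hc | hc | hc
    · lia
    · lia
    · have := hf .v (by simp only [IsForcingLabel]; lia)
      have := hf .bo (by simp only [IsForcingLabel]; lia)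
      lia
    · have := hf .c (by simp only [IsForcingLabel]; lia)
      have := hf .d (by simp only [IsForcingLabel]; lia)
      lia
    · have := hf .c (by simp only [IsForcingLabel]; lia)
      have := hf .bo (by simp only [IsForcingLabel]; lia)
      lia
    · have := hf .d (by simp only [IsForcingLabel]; lia)
      have := hf .ao (by simp only [IsForcingLabel]; lia)
      lia
    · have := hf .xe (by simp only [IsForcingLabel]; lia)
      have := hf .ao (by simp only [IsForcingLabel]; lia)
      have := hf .bo (by simp only [IsForcingLabel]; lia)
      lia
    · have := hf .u (by simp only [IsForcingLabel]; lia)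
      have := hf .ao (by simp only [IsForcingLabel]; lia)
      lia
  clear hf hcases
  cases l <;> lia

/-- A matching vector which vanishes on the forcing labels of another one is equal to it. -/
theorem eq_of_forcing (h : IsMatchingVector n x f) (h' : IsMatchingVector n x' f')
    (hx : f 0 .ul = 1 → x' = 0)
    (hf : ∀ k < n, ∀ l, IsForcingLabel (f (k + 1) .ul) (f k) l → f' k l = 0) :
    x' = x ∧ ∀ k < n, ∀ l, f' k l = f k l := by
  -- Induction on the distance `j` to the right end, where no connecting pair exists.
  have hle : ∀ j k, k + j = n → f k .ul = 0 → f' k .ul = 0 := by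
    intro j
    induction j with
    | zero => rintro k rfl -; exact h'.ul_last
    | succ j ih =>
      intro k hk
      exact h.ul_eq_zero_of_forcing h' (by omega) (hf k (by omega)) (ih (k + 1) (by omega))
  have hul_le : ∀ k ≤ n, f k .ul ≤ 1 := by
    intro k hk
    rcases hk.lt_or_eq with hk | rfl
    · have := h.u_odd k hk
      omega
    · simp [h.ul_last]
  -- From left to right: `hle` handles the value 0, and the value 1 propagates; it starts from `hx`,
  -- which removes `u_0 v_0`.
  have hul : ∀ k ≤ n, f' k .ul = f k .ul := by
    intro k
    induction k with
    | zero =>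
      intro hk
      have := hle n 0 (by omega)
      have := h.u_zero
      have := h'.u_zero
      omega
    | succ k ih =>
      intro hk
      have := hle (n - (k + 1)) (k + 1) (by omega)
      have := hul_le (k + 1) hk
      have := h.ul_eq_one_of_forcing h' hk (hf k hk) (ih (by omega))
      omega
  refine ⟨?_, fun k hk => h.block_eq_of_forcing h' hk (hf k hk) (hul k hk.le) (hul (k + 1) hk)⟩
  have := hul 0 (Nat.zero_le n)
  have := h.u_zero
  have := h'.u_zero
  omega

end IsMatchingVector

/-! ### Weights and alternating squares -/

/-- The value of a vector at the edge `u_{2k} v_{2k}`. -/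
def rung (x : ℕ) (f : ℕ → Label → ℕ) : ℕ → ℕ
  | 0 => x
  | k + 1 => f k .xe

/-- The sum of the values of a vector at `u_0 v_0` and at the edges of the first `m` blocks. -/
def total (x : ℕ) (f : ℕ → Label → ℕ) (m : ℕ) : ℕ :=
  x + ∑ k ∈ Finset.range m, ∑ l, f k l

theorem total_zero (x : ℕ) (f : ℕ → Label → ℕ) : total x f 0 = x := by
  simp [total]

theorem total_succ (x : ℕ) (f : ℕ → Label → ℕ) (m : ℕ) : total x f (m + 1) = total x f m +
    (f m .ul + f m .vl + f m .u + f m .v + f m .xo + f m .xe + f m .ao + f m .ae + f m .bo +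
      f m .be + f m .c + f m .d) := by
  unfold total
  rw [Finset.sum_range_succ, sum_label (f m)]
  ring

/-- The vector `(y, s)` is positive on every square that is alternating for `(x, f)`. -/
structure MeetsSquares (n : ℕ) (x : ℕ) (f : ℕ → Label → ℕ) (y : ℕ) (s : ℕ → Label → ℕ) :
    Prop where
  upper : ∀ k < n, f k .c = 1 → f k .u = 1 → 1 ≤ s k .ao + s k .ae
  upper' : ∀ k < n, f k .ao = 1 → f k .ae = 1 → 1 ≤ s k .c + s k .u
  lower : ∀ k < n, f k .d = 1 → f k .v = 1 → 1 ≤ s k .bo + s k .be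
  lower' : ∀ k < n, f k .bo = 1 → f k .be = 1 → 1 ≤ s k .d + s k .v
  middle : ∀ k < n, f k .u = 1 → f k .v = 1 → 1 ≤ s k .xo + s k .xe
  middle' : ∀ k < n, f k .xo = 1 → f k .xe = 1 → 1 ≤ s k .u + s k .v
  left : ∀ k < n, f k .ul = 1 → f k .vl = 1 → 1 ≤ rung y s k + s k .xo
  left' : ∀ k < n, rung x f k = 1 → f k .xo = 1 → 1 ≤ s k .ul + s k .vl

section

variable {n : ℕ} {M S : Set (Sym2 (Vertex n))}

theorem blockInd_eq_one_iff {k : ℕ} (hk : k < n) {l : Label} :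
    blockInd M k l = 1 ↔ edge (some (⟨k, hk⟩, l)) ∈ M := by
  simp [blockInd, hk]

theorem blockInd_eq_zero_iff {k : ℕ} (hk : k < n) {l : Label} :
    blockInd M k l = 0 ↔ edge (some (⟨k, hk⟩, l)) ∉ M := by
  simp [blockInd, hk]

theorem baseInd_eq_one_iff : baseInd M = 1 ↔ edge none ∈ M := by
  simp [baseInd]

theorem baseInd_eq_zero_iff : baseInd M = 0 ↔ edge none ∉ M := by
  simp [baseInd]

theorem rung_eq_one_iff {k : ℕ} (hk : k < n) : rung (baseInd M) (blockInd M) k = 1 ↔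
    s(.u ⟨2 * k, by omega⟩, .v ⟨2 * k, by omega⟩) ∈ M := by
  cases k with
  | zero => exact baseInd_eq_one_iff
  | succ k => exact blockInd_eq_one_iff (by omega)

theorem IsAntiForcingSet.edge_mem_or_mem (h : IsAntiForcingSet (polyominoGraph n) M S)
    {e₁ e₂ e₃ e₄ : Option (Fin n × Label)} (a b c d : Vertex n) (h₁ : edge e₁ = s(a, b))
    (h₂ : edge e₂ = s(b, c)) (h₃ : edge e₃ = s(c, d)) (h₄ : edge e₄ = s(d, a)) (hac : a ≠ c)
    (hbd : b ≠ d) (he₁ : edge e₁ ∈ M) (he₃ : edge e₃ ∈ M) : edge e₂ ∈ S ∨ edge e₄ ∈ S := by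
  rw [h₂, h₄]
  exact h.mem_or_mem (h₁ ▸ he₁) (h₃ ▸ he₃) (SimpleGraph.mem_edgeSet _ |>.1 <| h₂ ▸ edge_mem_edgeSet e₂)
    (SimpleGraph.mem_edgeSet _ |>.1 <| h₄ ▸ edge_mem_edgeSet e₄) hac hbd

theorem one_le_add_of_mem_or_mem {k : ℕ} (hk : k < n) {l l' : Label}
    (h : edge (some (⟨k, hk⟩, l)) ∈ S ∨ edge (some (⟨k, hk⟩, l')) ∈ S) :
    1 ≤ blockInd S k l + blockInd S k l' := by
  rw [← blockInd_eq_one_iff, ← blockInd_eq_one_iff] at h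
  omega

theorem exists_edge_rung {k : ℕ} (hk : k < n) : ∃ e : Option (Fin n × Label),
    edge e = s(.u ⟨2 * k, by omega⟩, .v ⟨2 * k, by omega⟩) := by
  cases k with
  | zero => exact ⟨none, rfl⟩
  | succ k => exact ⟨some (⟨k, by omega⟩, .xe), rfl⟩

theorem IsAntiForcingSet.meetsSquares (h : IsAntiForcingSet (polyominoGraph n) M S) :
    MeetsSquares n (baseInd M) (blockInd M) (baseInd S) (blockInd S) := by
  constructor <;> intro k hk
  · rw [blockInd_eq_one_iff hk, blockInd_eq_one_iff hk]
    intro h1 h2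
    exact one_le_add_of_mem_or_mem hk <| h.edge_mem_or_mem (.w ⟨2 * k + 1, by omega⟩)
      (.w ⟨2 * k, by omega⟩) (.u ⟨2 * k + 1, by omega⟩) (.u ⟨2 * k + 2, by omega⟩)
      (by exact Sym2.eq_swap) (by exact Sym2.eq_swap) (by exact rfl) (by exact rfl) (by simp) (by simp) h1 h2
  · rw [blockInd_eq_one_iff hk, blockInd_eq_one_iff hk]
    intro h1 h2
    exact one_le_add_of_mem_or_mem hk <| h.edge_mem_or_mem (.u ⟨2 * k + 1, by omega⟩)
      (.w ⟨2 * k, by omega⟩) (.w ⟨2 * k + 1, by omega⟩) (.u ⟨2 * k + 2, by omega⟩)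
      (by exact rfl) (by exact rfl) (by exact Sym2.eq_swap) (by exact Sym2.eq_swap) (by simp) (by simp) h1 h2
  · rw [blockInd_eq_one_iff hk, blockInd_eq_one_iff hk]
    intro h1 h2
    exact one_le_add_of_mem_or_mem hk <| h.edge_mem_or_mem (.z ⟨2 * k + 1, by omega⟩)
      (.z ⟨2 * k, by omega⟩) (.v ⟨2 * k + 1, by omega⟩) (.v ⟨2 * k + 2, by omega⟩)
      (by exact Sym2.eq_swap) (by exact Sym2.eq_swap) (by exact rfl) (by exact rfl) (by simp) (by simp) h1 h2
  · rw [blockInd_eq_one_iff hk, blockInd_eq_one_iff hk]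
    intro h1 h2
    exact one_le_add_of_mem_or_mem hk <| h.edge_mem_or_mem (.v ⟨2 * k + 1, by omega⟩)
      (.z ⟨2 * k, by omega⟩) (.z ⟨2 * k + 1, by omega⟩) (.v ⟨2 * k + 2, by omega⟩)
      (by exact rfl) (by exact rfl) (by exact Sym2.eq_swap) (by exact Sym2.eq_swap) (by simp) (by simp) h1 h2
  · rw [blockInd_eq_one_iff hk, blockInd_eq_one_iff hk]
    intro h1 h2
    exact one_le_add_of_mem_or_mem hk <| h.edge_mem_or_mem (.u ⟨2 * k + 2, by omega⟩)
      (.u ⟨2 * k + 1, by omega⟩) (.v ⟨2 * k + 1, by omega⟩) (.v ⟨2 * k + 2, by omega⟩)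
      (by exact Sym2.eq_swap) (by exact rfl) (by exact rfl) (by exact Sym2.eq_swap) (by simp) (by simp) h1 h2
  · rw [blockInd_eq_one_iff hk, blockInd_eq_one_iff hk]
    intro h1 h2
    exact one_le_add_of_mem_or_mem hk <| h.edge_mem_or_mem (.v ⟨2 * k + 1, by omega⟩)
      (.u ⟨2 * k + 1, by omega⟩) (.u ⟨2 * k + 2, by omega⟩) (.v ⟨2 * k + 2, by omega⟩)
      (by exact Sym2.eq_swap) (by exact rfl) (by exact rfl) (by exact Sym2.eq_swap) (by simp) (by simp) h1 h2
  · rw [blockInd_eq_one_iff hk, blockInd_eq_one_iff hk]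
    intro h1 h2
    -- The rung `u_{2k} v_{2k}` is `none` for `k = 0` and the edge `xe` of the previous block
    -- otherwise.
    obtain ⟨e, he⟩ := exists_edge_rung hk
    have := h.edge_mem_or_mem (e₂ := e) (e₄ := some (⟨k, hk⟩, .xo))
      (.u ⟨2 * k + 1, by omega⟩) (.u ⟨2 * k, by omega⟩) (.v ⟨2 * k, by omega⟩)
      (.v ⟨2 * k + 1, by omega⟩)
      (by exact Sym2.eq_swap) he (by exact rfl) (by exact Sym2.eq_swap) (by simp) (by simp) h1 h2
    rw [he, ← rung_eq_one_iff hk, ← blockInd_eq_one_iff] at this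
    omega
  · rw [rung_eq_one_iff hk, blockInd_eq_one_iff hk]
    intro h1 h2
    obtain ⟨e, he⟩ := exists_edge_rung hk
    exact one_le_add_of_mem_or_mem hk <| h.edge_mem_or_mem (e₁ := e) (.v ⟨2 * k, by omega⟩)
      (.u ⟨2 * k, by omega⟩) (.u ⟨2 * k + 1, by omega⟩) (.v ⟨2 * k + 1, by omega⟩)
      (he.trans Sym2.eq_swap) (by exact rfl) (by exact rfl) (by exact Sym2.eq_swap) (by simp) (by simp) (he ▸ h1) h2

open Classical in
theorem total_eq_card (M : Set (Sym2 (Vertex n))) :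
    total (baseInd M) (blockInd M) n = (Finset.univ.filter fun e => edge e ∈ M).card := by
  rw [Finset.card_filter, Fintype.sum_option, Fintype.sum_prod_type, total, Finset.sum_range]
  simp [-Finset.sum_boole, baseInd, blockInd]

theorem total_le_card (S : Finset (Sym2 (Vertex n))) :
    total (baseInd (S : Set (Sym2 (Vertex n)))) (blockInd (S : Set (Sym2 (Vertex n)))) n ≤
      S.card := by
  classical
  rw [total_eq_card, ← Finset.card_image_of_injective _ edge_injective]
  refine Finset.card_le_card fun e he => ?_
  simp only [Finset.mem_image, Finset.mem_filter, Finset.mem_coe] at he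
  obtain ⟨e, ⟨-, he⟩, rfl⟩ := he
  exact he

theorem card_le_total (S : Finset (Sym2 (Vertex n)))
    (hS : (S : Set (Sym2 (Vertex n))) ⊆ (polyominoGraph n).edgeSet) : S.card ≤
      total (baseInd (S : Set (Sym2 (Vertex n)))) (blockInd (S : Set (Sym2 (Vertex n)))) n := by
  classical
  rw [total_eq_card, ← Finset.card_image_of_injective _ edge_injective]
  refine Finset.card_le_card fun e he => ?_
  obtain ⟨e, rfl⟩ := range_edge.ge (hS he)
  exact Finset.mem_image_of_mem _ (by simpa using he)

end

/-! ### The lower bound for every perfect matching -/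

/-- Every set that meets all alternating squares of a perfect matching has at least `n` edges. -/
theorem MeetsSquares.le_total {n x y : ℕ} {f s : ℕ → Label → ℕ} (h : IsMatchingVector n x f)
    (hs : MeetsSquares n x f y s) {m : ℕ} (hm : m ≤ n) :
    m + 1 + rung y s m ≤ total y s m + f m .ul + rung x f m := by
  -- `f m .ul + rung x f m` is 1 or 0. If it is 0, column `2m` is covered inside the previous block,
  -- and the bound carries one surplus edge, obtained there from an upper and a lower square. The
  -- term `rung y s m` reserves the rung for the left square of the next block, so that it is not
  -- counted twice.
  induction m with
  | zero =>
    have := h.u_zero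
    simp only [rung, total_zero]
    omega
  | succ m ih =>
    have ih := ih (by omega)
    have hb := h.block hm
    rw [total_succ]
    change m + 1 + 1 + s m .xe ≤ _ + f (m + 1) .ul + f m .xe
    have h1 := hs.left m hm
    have h2 := hs.left' m hm
    have h3 := hs.middle' m hm
    have h4 := hs.upper m hm
    have h5 := hs.upper' m hm
    have h6 := hs.lower m hm
    have h7 := hs.lower' m hm
    have hr : f m .ul + rung x f m ≤ 1 := by
      cases m with
      | zero => exact (add_comm _ _).trans_le h.u_zero.le
      | succ m => have := h.u_even m (by omega); simp only [rung]; omega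
    rcases h.block_cases hm with hc | hc | hc | hc | hc | hc | hc | hc
    all_goals clear hs h; lia

/-! ### The cost of the forcing labels -/

open Classical in
/-- The number of edges in the forcing set of a matching `g` of a block, with `q` the value of the
matching on the edges that lead to the next block. -/
theorem IsMatchingVector.sum_isForcingLabel_le {n x : ℕ} {f : ℕ → Label → ℕ}
    (h : IsMatchingVector n x f) {k : ℕ} (hk : k < n) :
    ∑ l, (if IsForcingLabel (f (k + 1) .ul) (f k) l then 1 else 0) + f k .ul ≤
      f (k + 1) .ul + if f k .ul = 1 then 1 else if f k .ao = 1 ∧ f k .bo = 1 then 2 else 3 := by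
  have hb := h.block hk
  rw [sum_label]
  simp only [IsForcingLabel]
  generalize f k = g at *
  generalize f (k + 1) .ul = q at *
  -- In this order, counting `ul = 1` twice, the states have 0, 1, 4, 2, 3, 3, 3, 3 forcing labels.
  have hc : (g .ul = 1 ∧ (q = 0 ∨ q = 1)) ∨ (g .ul = 0 ∧ q = 1) ∨ (g .ao = 1 ∧ g .bo = 1) ∨
    (g .ao = 1 ∧ g .bo = 0) ∨ (g .ao = 0 ∧ g .bo = 1) ∨
    (g .u = 1 ∧ g .v = 1) ∨ (g .xo = 1 ∧ g .xe = 1) := by lia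
  clear h
  rcases hc with ⟨hc, hq | hq⟩ | hc | hc | hc | hc | hc | hc
  · have : g .ao = 0 ∧ g .bo = 0 ∧ g .u = 0 ∧ g .v = 0 ∧ g .xo = 0 := by lia
    simp [*]
  · have : g .ao = 0 ∧ g .bo = 0 ∧ g .u = 0 ∧ g .v = 0 ∧ g .xo = 0 := by lia
    simp [*]
  · have : g .ao = 0 ∧ g .bo = 0 ∧ g .u = 0 ∧ g .v = 0 ∧ g .xe = 0 := by lia
    simp [*]
  · have : g .ul = 0 ∧ q = 0 ∧ g .u = 0 ∧ g .v = 0 ∧ g .xo = 0 := by lia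
    simp [*]
  · have : g .ul = 0 ∧ q = 0 ∧ g .u = 0 ∧ g .v = 1 ∧ g .xo = 0 := by lia
    simp [*]
  · have : g .ul = 0 ∧ q = 0 ∧ g .u = 1 ∧ g .v = 0 ∧ g .xo = 0 := by lia
    simp [*]
  · have : g .ul = 0 ∧ q = 0 ∧ g .ao = 0 ∧ g .bo = 0 ∧ g .xo = 0 := by lia
    simp [*]
  · have : g .ul = 0 ∧ q = 0 ∧ g .ao = 0 ∧ g .bo = 0 ∧ g .u = 0 ∧ g .v = 0 := by lia
    simp [*]

/-! ### The explicit anti-forcing set and the bounds `n` and `3n` -/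

section ForcingSet

variable {n : ℕ} {M : Set (Sym2 (Vertex n))}

/-- The edges of an anti-forcing set of the perfect matching `M`. -/
def IsForcingEdge (M : Set (Sym2 (Vertex n))) : Option (Fin n × Label) → Prop
  | none => blockInd M 0 .ul = 1
  | some (k, l) => IsForcingLabel (blockInd M (k + 1) .ul) (blockInd M k) l

open Classical in
/-- An anti-forcing set of the perfect matching `M`. -/
noncomputable def forcingSet (M : Set (Sym2 (Vertex n))) : Finset (Sym2 (Vertex n)) :=
  (Finset.univ.filter (IsForcingEdge M)).image edge

theorem edge_mem_forcingSet {e : Option (Fin n × Label)} :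
    edge e ∈ forcingSet M ↔ IsForcingEdge M e := by
  classical
  simp [forcingSet, edge_injective.eq_iff]

theorem forcingSet_subset :
    (forcingSet M : Set (Sym2 (Vertex n))) ⊆ (polyominoGraph n).edgeSet := by
  classical
  intro e he
  obtain ⟨e, -, rfl⟩ := Finset.mem_image.1 (Finset.mem_coe.1 he)
  exact edge_mem_edgeSet e

theorem isAntiForcingSet_forcingSet (hn : 0 < n) (hM : M ∈ perfectMatchings (polyominoGraph n)) :
    IsAntiForcingSet (polyominoGraph n) M (forcingSet M) := by
  have hMG := (mem_perfectMatchings_iff.1 hM).1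
  have h := (mem_perfectMatchings_iff_isMatchingVector hMG hn).1 hM
  have hd : Disjoint M (forcingSet M) := by
    rw [Set.disjoint_left]
    intro e he
    obtain ⟨e, rfl⟩ := range_edge.ge (hMG he)
    rw [Finset.mem_coe, edge_mem_forcingSet]
    rcases e with _ | ⟨k, l⟩ <;> intro hf
    · have h1 := baseInd_eq_one_iff.2 he
      have := h.u_zero
      simp only [IsForcingEdge] at hf
      omega
    · have h1 := (blockInd_eq_one_iff k.2).2 he
      have := h.eq_zero_of_isForcingLabel k.2 hf
      omega
  refine ⟨Set.subset_sdiff.2 ⟨forcingSet_subset, hd.symm⟩, ?_⟩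
  apply Set.Subset.antisymm
  · intro M' hM'
    rw [mem_perfectMatchings_deleteEdges_iff] at hM'
    obtain ⟨hM', hd'⟩ := hM'
    have hMG' := (mem_perfectMatchings_iff.1 hM').1
    have h' := (mem_perfectMatchings_iff_isMatchingVector hMG' hn).1 hM'
    have hz : ∀ e, IsForcingEdge M e → edge e ∉ M' := fun e he he' =>
      Set.disjoint_left.1 hd' he' (edge_mem_forcingSet.2 he)
    obtain ⟨hx, hf⟩ := h.eq_of_forcing h' (fun hp => baseInd_eq_zero_iff.2 (hz none hp))
      fun k hk l hl => (blockInd_eq_zero_iff hk).2 (hz (some (⟨k, hk⟩, l)) hl)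
    have key : ∀ e, edge e ∈ M' ↔ edge e ∈ M := by
      rintro (_ | ⟨k, l⟩)
      · rw [← baseInd_eq_one_iff, ← baseInd_eq_one_iff, hx]
      · rw [← blockInd_eq_one_iff k.2, ← blockInd_eq_one_iff k.2, hf k k.2 l]
    ext e
    constructor
    · intro he
      obtain ⟨e, rfl⟩ := range_edge.ge (hMG' he)
      exact (key e).1 he
    · intro he
      obtain ⟨e, rfl⟩ := range_edge.ge (hMG he)
      exact (key e).2 he
  · rw [Set.singleton_subset_iff, mem_perfectMatchings_deleteEdges_iff]
    exact ⟨hM, hd⟩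

open Classical in
theorem sum_blockInd_forcingSet {k : ℕ} (hk : k < n) :
    ∑ l, blockInd (forcingSet M : Set (Sym2 (Vertex n))) k l =
      ∑ l, if IsForcingLabel (blockInd M (k + 1) .ul) (blockInd M k) l then 1 else 0 := by
  refine Finset.sum_congr rfl fun l _ => ?_
  split_ifs with hl
  · exact (blockInd_eq_one_iff hk).2 (edge_mem_forcingSet.2 hl)
  · exact (blockInd_eq_zero_iff hk).2 fun he => hl (edge_mem_forcingSet.1 he)

theorem total_forcingSet_zero : total (baseInd (forcingSet M : Set (Sym2 (Vertex n))))
    (blockInd (forcingSet M : Set (Sym2 (Vertex n)))) 0 ≤ blockInd M 0 .ul := by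
  by_cases hp : blockInd M 0 .ul = 1
  · rw [total_zero, hp, baseInd]
    split_ifs <;> simp
  · rw [total_zero, baseInd_eq_zero_iff.2]
    · exact Nat.zero_le _
    · rwa [Finset.mem_coe, edge_mem_forcingSet]

/-- The indicators of the connecting pairs telescope over the blocks: the first one pays for `u_0
v_0`, and the last one is 0. -/
theorem total_forcingSet_succ (hM : IsMatchingVector n (baseInd M) (blockInd M)) {m : ℕ}
    (hm : m < n) :
    total (baseInd (forcingSet M : Set (Sym2 (Vertex n))))
      (blockInd (forcingSet M : Set (Sym2 (Vertex n)))) (m + 1) + blockInd M m .ul ≤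
    total (baseInd (forcingSet M : Set (Sym2 (Vertex n))))
      (blockInd (forcingSet M : Set (Sym2 (Vertex n)))) m + blockInd M (m + 1) .ul +
      if blockInd M m .ul = 1 then 1
        else if blockInd M m .ao = 1 ∧ blockInd M m .bo = 1 then 2 else 3 := by
  have := hM.sum_isForcingLabel_le hm
  rw [← sum_blockInd_forcingSet hm] at this
  unfold total
  rw [Finset.sum_range_succ]
  omega

theorem card_forcingSet_le (hM : IsMatchingVector n (baseInd M) (blockInd M)) :
    (forcingSet M).card ≤ 3 * n := by
  have key : ∀ m ≤ n, total (baseInd (forcingSet M : Set (Sym2 (Vertex n))))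
      (blockInd (forcingSet M : Set (Sym2 (Vertex n)))) m ≤ 3 * m + blockInd M m .ul := by
    intro m
    induction m with
    | zero =>
      intro _
      have := total_forcingSet_zero (M := M)
      omega
    | succ m ih =>
      intro hm
      have := ih (by omega)
      have := total_forcingSet_succ hM hm
      split_ifs at this <;> omega
  have := key n le_rfl
  have := hM.ul_last
  have := card_le_total _ (forcingSet_subset (M := M))
  omega

theorem antiForcingNumber_mem_Icc (hn : 0 < n) (hM : M ∈ perfectMatchings (polyominoGraph n)) :
    antiForcingNumber (polyominoGraph n) M ∈ Set.Icc n (3 * n) := by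
  have h := (mem_perfectMatchings_iff_isMatchingVector (mem_perfectMatchings_iff.1 hM).1 hn).1 hM
  have hF := isAntiForcingSet_forcingSet hn hM
  refine ⟨le_antiForcingNumber hF fun T hT => ?_, antiForcingNumber_le hF (card_forcingSet_le h)⟩
  have h1 := hT.meetsSquares.le_total h le_rfl
  have h2 := total_le_card T
  have h3 := h.ul_last
  have h4 : rung (baseInd M) (blockInd M) n ≤ 1 := by
    obtain ⟨m, rfl⟩ := Nat.exists_eq_succ_of_ne_zero hn.ne'
    have := h.u_even m m.lt_succ_self
    simp only [rung]
    omega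
  omega

end ForcingSet

/-! ### A two-parameter family realizing all values -/

section Family

variable {n a b : ℕ}

/-- The perfect matching whose first `a` blocks are matched along the path, whose next `b` blocks
use the edges `u_i w_i` and `v_i z_i`, and which has only horizontal edges in the other blocks. -/
def IsFamilyLabel (a b k : ℕ) : Label → Prop
  | .ul | .vl => k < a
  | .u | .v => a + b ≤ k
  | .xo => False
  | .xe => k + 1 = a
  | .ao | .ae | .bo | .be => a ≤ k ∧ k < a + b
  | .c | .d => k < a ∨ a + b ≤ k

def IsFamilyEdge (a b : ℕ) : Option (Fin n × Label) → Prop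
  | none => a = 0
  | some (k, l) => IsFamilyLabel a b k l

def familyMatching (n a b : ℕ) : Set (Sym2 (Vertex n)) :=
  edge '' {e | IsFamilyEdge a b e}

theorem blockInd_familyMatching_eq_one_iff {k : ℕ} (hk : k < n) {l : Label} :
    blockInd (familyMatching n a b) k l = 1 ↔ IsFamilyLabel a b k l := by
  rw [blockInd_eq_one_iff hk, familyMatching, edge_injective.mem_set_image]
  rfl

theorem baseInd_familyMatching_eq_one_iff :
    baseInd (familyMatching n a b) = 1 ↔ a = 0 := by
  rw [baseInd_eq_one_iff, familyMatching, edge_injective.mem_set_image]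
  rfl

theorem blockInd_familyMatching (ha : a ≤ n) {k : ℕ} (l : Label) (hk : k < n ∨ l = .ul ∨ l = .vl) :
    IsFamilyLabel a b k l ∧ blockInd (familyMatching n a b) k l = 1 ∨
      ¬ IsFamilyLabel a b k l ∧ blockInd (familyMatching n a b) k l = 0 := by
  by_cases hk' : k < n
  · rw [blockInd_familyMatching_eq_one_iff hk', blockInd_eq_zero_iff hk', ← blockInd_eq_one_iff hk',
      blockInd_familyMatching_eq_one_iff hk']
    tauto
  · refine Or.inr ⟨?_, by simp [blockInd, hk']⟩
    obtain rfl | rfl := hk.resolve_left hk' <;> simp only [IsFamilyLabel] <;> omega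

theorem isMatchingVector_familyMatching (ha : a ≤ n) :
    IsMatchingVector n (baseInd (familyMatching n a b)) (blockInd (familyMatching n a b)) := by
  have hbase : baseInd (familyMatching n a b) = 1 ∧ a = 0 ∨
      baseInd (familyMatching n a b) = 0 ∧ ¬ a = 0 := by
    rw [baseInd_eq_zero_iff, ← baseInd_eq_one_iff, baseInd_familyMatching_eq_one_iff]
    tauto
  have hul (k : ℕ) := blockInd_familyMatching (b := b) (k := k) ha .ul (by simp)
  have hvl (k : ℕ) := blockInd_familyMatching (b := b) (k := k) ha .vl (by simp)
  have hblock (l : Label) {k : ℕ} (hk : k < n) :=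
    blockInd_familyMatching (b := b) ha l (Or.inl hk)
  simp only [IsFamilyLabel] at hul hvl
  constructor
  case u_zero => have := hul 0; omega
  case v_zero => have := hvl 0; omega
  case ul_last => simp [blockInd]
  case vl_last => simp [blockInd]
  all_goals
    intro k hk
    have h1 := hul k
    have h2 := hul (k + 1)
    have h3 := hvl k
    have h4 := hvl (k + 1)
    have h5 := hblock .u hk
    have h6 := hblock .v hk
    have h7 := hblock .xo hk
    have h8 := hblock .xe hk
    have h9 := hblock .ao hk
    have h10 := hblock .ae hk
    have h11 := hblock .bo hk
    have h12 := hblock .be hk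
    have h13 := hblock .c hk
    have h14 := hblock .d hk
    simp only [IsFamilyLabel, false_and, not_false_eq_true, true_and, false_or] at h5 h6 h7 h8
    simp only [IsFamilyLabel] at h9 h10 h11 h12 h13 h14
    clear hul hvl hblock
    -- The last path block, `k + 1 = a`, is separate: it ends with the rung `xe` instead of a
    -- connecting pair.
    have : k + 1 < a ∨ k + 1 = a ∨ a ≤ k ∧ k < a + b ∨ a + b ≤ k := by omega
    rcases this with hk | hk | hk | hk <;> omega

theorem familyMatching_mem (hn : 0 < n) (ha : a ≤ n) :
    familyMatching n a b ∈ perfectMatchings (polyominoGraph n) := by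
  rw [mem_perfectMatchings_iff_isMatchingVector _ hn]
  · exact isMatchingVector_familyMatching ha
  · rintro _ ⟨e, -, rfl⟩
    exact edge_mem_edgeSet e

theorem card_forcingSet_familyMatching_le (ha : a ≤ n) :
    (forcingSet (familyMatching n a b)).card ≤ n + (n - a) + (n - a - b) := by
  have hM := isMatchingVector_familyMatching (b := b) ha
  have key : ∀ m ≤ n, total (baseInd (forcingSet (familyMatching n a b) : Set (Sym2 (Vertex n))))
      (blockInd (forcingSet (familyMatching n a b) : Set (Sym2 (Vertex n)))) m ≤
      m + (m - a) + (m - a - b) + blockInd (familyMatching n a b) m .ul := by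
    intro m
    induction m with
    | zero =>
      intro _
      have := total_forcingSet_zero (M := familyMatching n a b)
      omega
    | succ m ih =>
      intro hm
      have := ih (by omega)
      have := total_forcingSet_succ hM hm
      have h1 := blockInd_familyMatching_eq_one_iff (a := a) (b := b) hm (l := .ul)
      have h2 := blockInd_familyMatching_eq_one_iff (a := a) (b := b) hm (l := .ao)
      have h3 := blockInd_familyMatching_eq_one_iff (a := a) (b := b) hm (l := .bo)
      simp only [IsFamilyLabel] at h1 h2 h3
      simp only [h1, h2, h3, and_self] at this
      split_ifs at this <;> lia
  have := key n le_rfl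
  have := hM.ul_last
  have := card_le_total _ (forcingSet_subset (M := familyMatching n a b))
  omega

/-- The left square is used in each path block, the upper and lower squares in the next `b` blocks,
and the upper, lower and middle squares in the others. Their non-matching edges are pairwise
disjoint. The `if` term reserves the rung shared with the next path block. -/
theorem le_total_of_meetsSquares_familyMatching {y : ℕ} {s : ℕ → Label → ℕ}
    (hs : MeetsSquares n (baseInd (familyMatching n a b)) (blockInd (familyMatching n a b)) y s)
    {m : ℕ} (hm : m ≤ n) :
    m + (m - a) + (m - a - b) + (if m ≤ a then rung y s m else 0) ≤ total y s m := by
  induction m with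
  | zero => simp [rung, total_zero]
  | succ m ih =>
    have ih := ih (by omega)
    rw [total_succ]
    have h1 := hs.left m hm
    have h2 := hs.upper m hm
    have h3 := hs.upper' m hm
    have h4 := hs.lower m hm
    have h5 := hs.lower' m hm
    have h6 := hs.middle m hm
    simp only [blockInd_familyMatching_eq_one_iff hm, IsFamilyLabel] at h1 h2 h3 h4 h5 h6
    change _ + (if m + 1 ≤ a then s m .xe else 0) ≤ _
    clear hs
    rcases lt_or_ge m a with hma | hma
    · rw [if_pos hma.le] at ih
      rw [if_pos (by omega)]
      lia
    · rw [if_neg (by omega)]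
      lia

theorem antiForcingNumber_familyMatching (hn : 0 < n) (ha : a ≤ n) :
    antiForcingNumber (polyominoGraph n) (familyMatching n a b) =
      n + (n - a) + (n - a - b) := by
  have hF := isAntiForcingSet_forcingSet hn (familyMatching_mem (b := b) hn ha)
  refine le_antisymm (antiForcingNumber_le hF (card_forcingSet_familyMatching_le ha))
    (le_antiForcingNumber hF fun T hT => ?_)
  have h1 := le_total_of_meetsSquares_familyMatching hT.meetsSquares le_rfl
  have h2 := total_le_card T
  omega

end Family

theorem antiForcingSpectrum_polyominoGraph {n : ℕ} (hn : 0 < n) :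
    antiForcingSpectrum (polyominoGraph n) = Set.Icc n (3 * n) := by
  apply Set.Subset.antisymm
  · rintro _ ⟨M, hM, rfl⟩
    exact antiForcingNumber_mem_Icc hn hM
  · rintro k ⟨hk, hk'⟩
    have ha : n - (k - n) % 2 - (k - n) / 2 ≤ n := by omega
    refine ⟨familyMatching n (n - (k - n) % 2 - (k - n) / 2) ((k - n) % 2),
      familyMatching_mem hn ha, ?_⟩
    rw [antiForcingNumber_familyMatching hn ha]
    omega

end AntiForcing

theorem corollary4p3 (n : ℕ) (hn : 1 ≤ n) :
    (IsLeast (AntiForcing.antiForcingSpectrum (AntiForcing.polyominoGraph n)) n ∧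
      IsGreatest (AntiForcing.antiForcingSpectrum (AntiForcing.polyominoGraph n)) (3 * n)) ∧
    AntiForcing.antiForcingSpectrum (AntiForcing.polyominoGraph n) = Set.Icc n (3 * n) := by
  rw [AntiForcing.antiForcingSpectrum_polyominoGraph hn]
  have h : n ≤ 3 * n := by omega
  exact ⟨⟨isLeast_Icc h, isGreatest_Icc h⟩, rfl⟩
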